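/- Let $n\ge 0$ and let $\mathrm{Dyck}_n$ be the set of Dyck paths of semilength $n$, i.e. words $P=s_1\cdots s_{2n}$ in up-steps $U=(1,1)$ and down-steps $D=(1,-1)$ describing lattice paths from $(0,0)$ to $(2n,0)$ that never go below the $x$-axis; $\emptyset$ is the empty path. Put $$\mathrm{sumpeaks}(P)=\sum_{p:\,s_ps_{p+1}=UD}(\mathrm{ht}(p)-1),\qquad \mathrm{sumups}(P)=\sum_{i:\,s_i=U}\lceil h(i)/2\rceil ,$$ where $\mathrm{ht}(p)$ is the $y$-coordinate of the highest point of the peak $p$ and $h(i)$ is the $y$-coordinate of the lowest point of the step $s_i$. Define maps $\Psi,\Phi,\Theta$ on Dyck paths recursively, each sending $\emptyset$ to $\emptyset$, as follows. * For Dyck paths $Q=U^{a_1}D^{b_1}\cdots U^{a_s}D^{b_s}$ and $R=U^{c_1}D^{d_1}\cdots U^{c_t}D^{d_t}$ (positive exponents; $s=1$, $a_1=b_1=0$ if $Q=\emptyset$) let $\delta(Q,R)=U^{a_1+1}D^{b_1+1}U^{a_2}D^{b_2}\cdots U^{a_s}D^{b_s}$ if $R=\emptyset$, and $\delta(Q,R)=U^{a_1+1}DU^{a_2}D^{b_1}U^{a_3}D^{b_2}\cdots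 U^{a_s}D^{b_{s-1}}U^{c_1}D^{b_s+d_1}U^{c_2}D^{d_2}\cdots U^{c_t}D^{d_t}$ otherwise; $\delta$ is a bijection from pairs of Dyck paths onto nonempty Dyck paths. For $P=\delta(Q,R)$, $\Psi(P)$ is $UD\,\Psi(Q)$ if $R=\emptyset$, $U\,\Psi(R)\,D$ if $Q=\emptyset$, and $U\,\Psi(Q)\,D\,\Psi(R)$ otherwise. * If $P=UP_1D\,UP_2D\cdots UP_mD$ with $m\ge1$ and Dyck paths $P_i$, then $\Phi(P)=U^mD\,\Phi(P_1)\,D\,\Phi(P_2)\cdots D\,\Phi(P_m)$. * $\Theta(P_1\cdots P_r)=\Theta(P_1)\cdots\Theta(P_r)$ if each $P_i$ is a nonempty Dyck path returning to the $x$-axis only at its endpoint; $\Theta(UD)=UD$; and $\Theta(U\,UQ_1D\,UQ_2D\cdots UQ_sD\,D)=U^{s+1}D\,\Theta(Q_1)\,D\,\Theta(Q_2)\cdots D\,\Theta(Q_s)\,D$ for $s\ge1$ and Dyck paths $Q_i$. Then $\Psi,\Phi,\Theta$ restrict to bijections of $\mathrm{Dyck}_n$, and the bijection $\Lambda=\Theta^{-1}\circ\Phi\circ\Psi:\mathrm{Dyck}_n\to\mathrm{Dyck}_n$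 satisfies $\mathrm{sumpeaks}(P)=\mathrm{sumups}(\Lambda(P))$ for all $P\in\mathrm{Dyck}_n$. In particular $\mathrm{sumpeaks}$ and $\mathrm{sumups}$ are equidistributed on $\mathrm{Dyck}_n$: $$\sum_{P\in\mathrm{Dyck}_n}q^{\mathrm{sumpeaks}(P)}=\sum_{P\in\mathrm{Dyck}_n}q^{\mathrm{sumups}(P)} .$$ (This answers a question of Burstein and Elizalde.) -/

import Mathlib

open DyckStep

namespace DyckPaths

/-- The Dyck paths of semilength `n` (that is, of length `2n`). -/
abbrev Dyck (n : ℕ) : Type := {P : DyckWord // P.semilength = n}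

/-! ### Statistics. The steps of `P` are `P.toList[0], P.toList[1], …`; step `i` goes from the lattice
point with `x`-coordinate `i` to the one with `x`-coordinate `i + 1`. -/

/-- The `y`-coordinate of `P` at `x`-coordinate `x`. (The subtraction does not truncate, as `P` does
not go below the `x`-axis.) -/
def height (P : DyckWord) (x : ℕ) : ℕ :=
  (P.toList.take x).count U - (P.toList.take x).count D

/-- The peaks of `P`: the indices `i` such that steps `i`, `i + 1` are `U`, `D`. The highest point of
the peak `i` has `x`-coordinate `i + 1`. -/
def peaks (P : DyckWord) : Finset ℕ :=
  (Finset.range P.toList.length).filter fun i => P.toList[i]? = some U ∧ P.toList[i + 1]? = some D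

/-- The indices of the up-steps of `P`. The lowest point of the up-step `i` has `x`-coordinate `i`. -/
def upSteps (P : DyckWord) : Finset ℕ :=
  (Finset.range P.toList.length).filter fun i => P.toList[i]? = some U

/-- The sum of (height of the peak) - 1 over all peaks; a peak has height at least `1`. -/
def sumpeaks (P : DyckWord) : ℕ := ∑ i ∈ peaks P, (height P (i + 1) - 1)

/-- The sum of `⌈height / 2⌉` over all up-steps, where the height of a step is the `y`-coordinate of
its lowest point. -/
def sumups (P : DyckWord) : ℕ := ∑ i ∈ upSteps P, ⌈(height P i : ℚ) / 2⌉₊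

/-! ### The map `Ψ` -/

/-- The word `U^{a₁} D^{b₁} ⋯ U^{aₛ} D^{bₛ}` for the list `[(a₁, b₁), …, (aₛ, bₛ)]`. -/
def ofRuns (L : List (ℕ × ℕ)) : List DyckStep :=
  L.flatMap fun r => List.replicate r.1 U ++ List.replicate r.2 D

/-- The exponents of the run decomposition of a word. For a nonempty Dyck word, which starts with `U`
and ends with `D`, all exponents are positive. -/
def runs : List DyckStep → List (ℕ × ℕ)
  | [] => []
  | U :: w =>
    match runs w with
    | [] => [(1, 0)]
    | (a, b) :: L => (a + 1, b) :: L
  | D :: w =>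
    match runs w with
    | [] => [(0, 1)]
    | (0, b) :: L => (0, b + 1) :: L
    | (a + 1, b) :: L => (0, 1) :: (a + 1, b) :: L

theorem ofRuns_runs (w : List DyckStep) : ofRuns (runs w) = w := by
  induction w with
  | nil => rfl
  | cons s w ih =>
    cases s
    · rw [runs]
      split <;> rename_i h <;> rw [h] at ih <;> rw [← ih] <;> simp [ofRuns, List.replicate_succ]
    · rw [runs]
      split <;> rename_i h <;> rw [h] at ih <;> rw [← ih] <;> simp [ofRuns, List.replicate_succ]

/-- The exponents of `Q`, with the convention `s = 1`, `a₁ = b₁ = 0` for the empty path. -/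
def exponents (Q : DyckWord) : List (ℕ × ℕ) := if Q = 0 then [(0, 0)] else runs Q.toList

/-- `shiftRuns k [(a₁, b₁), …, (aₛ, bₛ)] [(c₁, d₁), …, (cₜ, dₜ)]` is the list
`[(a₁, k), (a₂, b₁), …, (aₛ, bₛ₋₁), (c₁, bₛ + d₁), (c₂, d₂), …, (cₜ, dₜ)]`. -/
def shiftRuns : ℕ → List (ℕ × ℕ) → List (ℕ × ℕ) → List (ℕ × ℕ)
  | _, [], [] => []
  | k, [], (c, d) :: M => (c, k + d) :: M
  | k, (a, b) :: L, M => (a, k) :: shiftRuns b L M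

/-- The word `δ(Q, R)`. For `Q = U^{a₁} D^{b₁} ⋯ U^{aₛ} D^{bₛ}` and `R = U^{c₁} D^{d₁} ⋯ U^{cₜ} D^{dₜ}`
it is `U^{a₁+1} D^{b₁+1} U^{a₂} D^{b₂} ⋯ U^{aₛ} D^{bₛ}` if `R` is empty, and otherwise
`U^{a₁+1} D U^{a₂} D^{b₁} ⋯ U^{aₛ} D^{bₛ₋₁} U^{c₁} D^{bₛ+d₁} U^{c₂} D^{d₂} ⋯ U^{cₜ} D^{dₜ}`. -/
def delta (Q R : DyckWord) : List DyckStep :=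
  match exponents Q with
  | [] => []
  | (a, b) :: L =>
    if R = 0 then ofRuns ((a + 1, b + 1) :: L)
    else ofRuns (shiftRuns 1 ((a + 1, b) :: L) (runs R.toList))

/-- `(Q, R)` is a preimage of `P` under
`δ : ⨆_{k < n} Dyck_k × Dyck_{n-k-1} → Dyck_n`, where `n` is the semilength of `P`. -/
def IsDeltaPreimage (P : DyckWord) (QR : DyckWord × DyckWord) : Prop :=
  QR.1.semilength + QR.2.semilength + 1 = P.semilength ∧ delta QR.1 QR.2 = P.toList

open Classical in
/-- With `(Q, R) = δ⁻¹(P)`: `Ψ(P) = UDΨ(Q)` if `R` is empty, `UΨ(R)D` if `Q` is empty, and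
`UΨ(Q)DΨ(R)` otherwise. As `δ` is a bijection onto the nonempty Dyck paths, the last branch of the
definition is used only for the empty path. (`p.nest` is the path `UpD`, and `+` is concatenation.) -/
noncomputable def Psi (P : DyckWord) : DyckWord :=
  if h : ∃ QR : DyckWord × DyckWord, IsDeltaPreimage P QR then
    if h.choose.2 = 0 then (0 : DyckWord).nest + Psi h.choose.1
    else if h.choose.1 = 0 then (Psi h.choose.2).nest
    else (Psi h.choose.1).nest + Psi h.choose.2
  else 0
termination_by P.semilength
decreasing_by all_goals (have := h.choose_spec.1; omega)

/-! ### The maps `Φ` and `Θ` -/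

/-- The list `[P₁, …, Pₘ]` of Dyck paths such that `P = U P₁ D U P₂ D ⋯ U Pₘ D`. -/
def components (P : DyckWord) : List DyckWord :=
  if h : P = 0 then [] else P.insidePart :: components P.outsidePart
termination_by P.semilength
decreasing_by exact DyckWord.semilength_outsidePart_lt (by assumption)

theorem sum_nest_components (P : DyckWord) : ((components P).map DyckWord.nest).sum = P := by
  rw [components]
  split
  · simp_all
  · rename_i h
    rw [List.map_cons, List.sum_cons, sum_nest_components P.outsidePart,
      DyckWord.nest_insidePart_add_outsidePart h]
termination_by P.semilength
decreasing_by exact DyckWord.semilength_outsidePart_lt (by assumption)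

theorem semilength_lt_of_mem_components {P Q : DyckWord} (hQ : Q ∈ components P) :
    Q.semilength < P.semilength := by
  rw [components] at hQ
  split at hQ
  · simp at hQ
  · rename_i h
    rcases List.mem_cons.1 hQ with rfl | hQ'
    · exact DyckWord.semilength_insidePart_lt h
    · exact (semilength_lt_of_mem_components hQ').trans (DyckWord.semilength_outsidePart_lt h)
termination_by P.semilength
decreasing_by exact DyckWord.semilength_outsidePart_lt (by assumption)

/-- The Dyck path `U^m D X₁ D X₂ ⋯ D Xₘ` for the list `[X₁, …, Xₘ]`, see `toList_staircase`. -/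
def staircase (L : List DyckWord) : DyckWord := L.foldl (fun p X => p.nest + X) 0

theorem toList_staircase (L : List DyckWord) :
    (staircase L).toList = List.replicate L.length U ++ L.flatMap fun X => D :: X.toList := by
  induction L using List.reverseRecOn with
  | nil => rfl
  | append_singleton L X ih =>
    have h : staircase (L ++ [X]) = (staircase L).nest + X := by simp [staircase]
    have h' : (staircase (L ++ [X])).toList = [U] ++ (staircase L).toList ++ [D] ++ X.toList := by
      rw [h]; rfl
    rw [h', ih]
    simp [List.replicate_succ]

/-- `Φ(U P₁ D U P₂ D ⋯ U Pₘ D) = U^m D Φ(P₁) D Φ(P₂) ⋯ D Φ(Pₘ)`. -/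
def Phi (P : DyckWord) : DyckWord :=
  staircase ((components P).attach.map fun Q => Phi Q.1)
termination_by P.semilength
decreasing_by exact semilength_lt_of_mem_components Q.2

theorem Phi_eq (P : DyckWord) : Phi P = staircase ((components P).map Phi) := by
  rw [Phi, List.attach_map_val]

/-- `Θ(∅) = ∅`; for `P = C R`, where `C` is the part of `P` up to the first return to the axis,
`Θ(P) = Θ(C) Θ(R)`; and for `C = U U Q₁ D U Q₂ D ⋯ U Qₛ D D` (with `C = UD` for `s = 0`),
`Θ(C) = U (U^s D Θ(Q₁) D Θ(Q₂) ⋯ D Θ(Qₛ)) D`. -/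
def Theta (P : DyckWord) : DyckWord :=
  if h : P = 0 then 0
  else
    (staircase ((components P.insidePart).attach.map fun Q => Theta Q.1)).nest + Theta P.outsidePart
termination_by P.semilength
decreasing_by
  · exact (semilength_lt_of_mem_components Q.2).trans (DyckWord.semilength_insidePart_lt h)
  · exact DyckWord.semilength_outsidePart_lt h

theorem Theta_eq (P : DyckWord) (h : P ≠ 0) :
    Theta P = (staircase ((components P.insidePart).map Theta)).nest + Theta P.outsidePart := by
  rw [Theta, dif_neg h, List.attach_map_val]

end DyckPaths

namespace DyckPaths

/-! Both statistics are compared with a third, `sumnested`, whose value on `U P D Q` is the sum of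
its values on `P` and `Q`, plus `|P| + 1` unless `Q` is empty (`|P|` is the semilength).

In `δ(Q, R)` with `Q`, `R` nonempty, the first peak is raised by 1, and every later peak of `Q` and
the first peak of `R` by the down-run of `Q` that is held back before it. So `sumpeaks` gains `|Q| +
1` (`sumpeaks_delta`). The case distinction in `Ψ` turns this into the recursion of `sumnested`
(`exists_Psi_eq`, `sumnested_Psi`).

Lifting a path by two adds 1 per up-step to `sumups`. Hence the first arch `U A D` contributes
`sumups R + |R| + 1` for each component `R` of `A` (`sumups_nest_add`). On `U P₁ D ⋯ U Pₘ D`,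
`sumnested` is the same kind of sum over `P₁, …, Pₘ₋₁`, plus its value on `Pₘ`. As staircases decode
uniquely, `Φ(P) = Θ(P')` matches `P₁, …, Pₘ₋₁` with the components of `A` and `Pₘ` with the rest of
`P'`; induction gives `sumnested_eq_sumups`.

All three maps are injective and preserve semilength, hence are bijections on the finite set of
paths of semilength `n`. -/

/-! ### Words from height `h` down to the axis -/

/-- The word `w`, started at height `h`, never goes below the axis and ends on it. -/
def IsDescent : ℕ → List DyckStep → Prop
  | h, [] => h = 0
  | h, U :: w => IsDescent (h + 1) w
  | h, D :: w => 0 < h ∧ IsDescent (h - 1) w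

theorem isDescent_iff (h : ℕ) (w : List DyckStep) :
    IsDescent h w ↔ h + w.count U = w.count D ∧
      ∀ i, (w.take i).count D ≤ h + (w.take i).count U := by
  induction w generalizing h with
  | nil => simp [IsDescent]
  | cons s w ih =>
    cases s
    · rw [IsDescent, ih]
      simp only [List.count_cons]
      constructor
      · rintro ⟨h1, h2⟩
        refine ⟨by simp; omega, fun i => ?_⟩
        rcases i with - | i
        · simp
        · have := h2 i
          simp; omega
      · rintro ⟨h1, h2⟩
        refine ⟨by simp at h1; omega, fun i => ?_⟩
        have := h2 (i + 1)
        simp at this; omega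
    · rw [IsDescent, ih]
      simp only [List.count_cons]
      constructor
      · rintro ⟨h0, h1, h2⟩
        refine ⟨by simp; omega, fun i => ?_⟩
        rcases i with - | i
        · simp
        · have := h2 i
          simp; omega
      · rintro ⟨h1, h2⟩
        -- The prefix of length one is a single `D`, which forces `0 < h`.
        have h3 := h2 1
        simp at h3
        refine ⟨by omega, by simp at h1; omega, fun i => ?_⟩
        have := h2 (i + 1)
        simp at this; omega

theorem isDescent_toList (P : DyckWord) : IsDescent 0 P.toList :=
  (isDescent_iff _ _).2 ⟨by rw [zero_add, P.count_U_eq_count_D], fun i => by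
    rw [zero_add]; exact P.count_D_le_count_U i⟩

theorem exists_toList_eq {w : List DyckStep} (hw : IsDescent 0 w) :
    ∃ P : DyckWord, P.toList = w := by
  rw [isDescent_iff] at hw
  exact ⟨⟨w, by rw [← hw.1, zero_add], fun i => by simpa using hw.2 i⟩, rfl⟩

/-! ### Recursive forms of the statistics -/

/-- The sum of `⌈height / 2⌉` over the up-steps of `w`, started at height `h`. -/
def upsum : ℕ → List DyckStep → ℕ
  | _, [] => 0
  | h, U :: w => ⌈(h : ℚ) / 2⌉₊ + upsum (h + 1) w
  | h, D :: w => upsum (h - 1) w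

/-- The sum of (height of the peak) - 1 over the peaks of `w`, started at height `h`. -/
def peaksum : ℕ → List DyckStep → ℕ
  | _, [] => 0
  | h, U :: w => (if w[0]? = some D then h else 0) + peaksum (h + 1) w
  | h, D :: w => peaksum (h - 1) w

/-- `IsDescent` guarantees that the `h - 1` in the recursion never truncates. -/
theorem upsum_eq_sum {h : ℕ} {w : List DyckStep} (hw : IsDescent h w) :
    upsum h w = ∑ i ∈ Finset.range w.length, if w[i]? = some U then
      ⌈((h + (w.take i).count U - (w.take i).count D : ℕ) : ℚ) / 2⌉₊ else 0 := by
  induction w generalizing h with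
  | nil => simp [upsum]
  | cons s w ih =>
    rw [List.length_cons, Finset.sum_range_succ']
    cases s
    · rw [upsum, ih hw, add_comm]
      congr 1
      · refine Finset.sum_congr rfl fun i _ => ?_
        simp [add_assoc, add_comm 1]
    · obtain ⟨h0, hw⟩ := hw
      rw [upsum, ih hw]
      simp only [List.getElem?_cons_zero, List.getElem?_cons_succ]
      rw [if_neg (by simp), add_zero]
      refine Finset.sum_congr rfl fun i _ => ?_
      have : h - 1 + (w.take i).count U - (w.take i).count D =
        h + ((D :: w).take (i + 1)).count U - ((D :: w).take (i + 1)).count D := by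
        simp; omega
      rw [this]

theorem peaksum_eq_sum {h : ℕ} {w : List DyckStep} (hw : IsDescent h w) :
    peaksum h w = ∑ i ∈ Finset.range w.length, if w[i]? = some U ∧ w[i + 1]? = some D then
      h + (w.take (i + 1)).count U - (w.take (i + 1)).count D - 1 else 0 := by
  induction w generalizing h with
  | nil => simp [peaksum]
  | cons s w ih =>
    rw [List.length_cons, Finset.sum_range_succ']
    cases s
    · rw [peaksum, ih hw, add_comm]
      congr 1
      · refine Finset.sum_congr rfl fun i _ => ?_
        simp only [List.getElem?_cons_succ]
        refine if_congr Iff.rfl ?_ rfl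
        rw [List.take_succ_cons]
        simp only [List.count_cons]
        simp; omega
      · simp
    · obtain ⟨h0, hw⟩ := hw
      rw [peaksum, ih hw]
      simp only [List.getElem?_cons_zero, List.getElem?_cons_succ]
      rw [if_neg (by simp), add_zero]
      refine Finset.sum_congr rfl fun i _ => if_congr Iff.rfl ?_ rfl
      rw [List.take_succ_cons]
      simp only [List.count_cons]
      simp; omega

theorem sumups_eq_upsum (P : DyckWord) : sumups P = upsum 0 P.toList := by
  rw [upsum_eq_sum (isDescent_toList P), sumups, upSteps, Finset.sum_filter]
  simp [height]

theorem sumpeaks_eq_peaksum (P : DyckWord) : sumpeaks P = peaksum 0 P.toList := by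
  rw [peaksum_eq_sum (isDescent_toList P), sumpeaks, peaks, Finset.sum_filter]
  simp [height]

/-! ### Induction on Dyck words, and `sumups` -/

theorem dyckWord_induction {p : DyckWord → Prop} (zero : p 0)
    (nest_add : ∀ P Q, p P → p Q → p (P.nest + Q)) (P : DyckWord) : p P := by
  by_cases h : P = 0
  · exact h ▸ zero
  · rw [← DyckWord.nest_insidePart_add_outsidePart h]
    exact nest_add _ _ (dyckWord_induction zero nest_add _) (dyckWord_induction zero nest_add _)
termination_by P.semilength
decreasing_by
  · exact DyckWord.semilength_insidePart_lt h
  · exact DyckWord.semilength_outsidePart_lt h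

theorem toList_nest_add (P Q : DyckWord) :
    (P.nest + Q).toList = U :: (P.toList ++ D :: Q.toList) := by
  change [U] ++ P.toList ++ [D] ++ Q.toList = _
  simp

/-- A Dyck word returns to its starting height, so what follows it starts at `h` again. -/
theorem upsum_toList_append (h : ℕ) (P : DyckWord) (w : List DyckStep) :
    upsum h (P.toList ++ w) = upsum h P.toList + upsum h w := by
  induction P using dyckWord_induction generalizing h w with
  | zero => exact (zero_add _).symm
  | nest_add P Q hP hQ =>
    simp [toList_nest_add, upsum, hP, hQ, add_assoc]

theorem upsum_nest_add (h : ℕ) (P Q : DyckWord) :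
    upsum h (P.nest + Q).toList =
      ⌈(h : ℚ) / 2⌉₊ + upsum (h + 1) P.toList + upsum h Q.toList := by
  simp [toList_nest_add, upsum, upsum_toList_append, add_assoc]

/-- Each up-step gains exactly 1, since `⌈(h + 2) / 2⌉ = ⌈h / 2⌉ + 1`. -/
theorem upsum_add_two (h : ℕ) (P : DyckWord) :
    upsum (h + 2) P.toList = upsum h P.toList + P.semilength := by
  induction P using dyckWord_induction generalizing h with
  | zero => rfl
  | nest_add P Q hP hQ =>
    have h2 : ⌈((h + 2 : ℕ) : ℚ) / 2⌉₊ = ⌈(h : ℚ) / 2⌉₊ + 1 := by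
      rw [← Nat.ceil_add_one (by positivity)]
      congr 1
      push_cast
      ring
    rw [upsum_nest_add, upsum_nest_add, h2, hQ, show h + 2 + 1 = h + 1 + 2 from rfl, hP]
    simp only [DyckWord.semilength_add, DyckWord.semilength_nest]
    omega

theorem nest_add_inj {P Q P' Q' : DyckWord} :
    P.nest + Q = P'.nest + Q' ↔ P = P' ∧ Q = Q' := by
  refine ⟨fun h => ?_, by rintro ⟨rfl, rfl⟩; rfl⟩
  have h1 := congrArg DyckWord.insidePart h
  have h2 := congrArg DyckWord.outsidePart h
  simpa [DyckWord.insidePart_add, DyckWord.outsidePart_add, DyckWord.insidePart_nest,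
    DyckWord.outsidePart_nest] using And.intro h1 h2

theorem nest_add_ne_zero (P Q : DyckWord) : P.nest + Q ≠ 0 := by
  rw [← DyckWord.toList_ne_nil, toList_nest_add]
  simp

theorem components_zero : components 0 = [] := by
  rw [components, dif_pos rfl]

theorem components_nest_add (P Q : DyckWord) :
    components (P.nest + Q) = P :: components Q := by
  rw [components, dif_neg (nest_add_ne_zero P Q), DyckWord.insidePart_add DyckWord.nest_ne_zero,
    DyckWord.outsidePart_add DyckWord.nest_ne_zero, DyckWord.insidePart_nest,
    DyckWord.outsidePart_nest, zero_add]

theorem components_injective : Function.Injective components := fun P Q h => by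
  rw [← sum_nest_components P, h, sum_nest_components]

theorem Theta_zero : Theta 0 = 0 := by
  rw [Theta, dif_pos rfl]

theorem Theta_nest_add (P Q : DyckWord) :
    Theta (P.nest + Q) = (staircase ((components P).map Theta)).nest + Theta Q := by
  rw [Theta_eq _ (nest_add_ne_zero P Q), DyckWord.insidePart_add DyckWord.nest_ne_zero,
    DyckWord.outsidePart_add DyckWord.nest_ne_zero, DyckWord.insidePart_nest,
    DyckWord.outsidePart_nest, zero_add]

/-- The initial up-step of each arch lies at height 1 and contributes 1; the interior lies at height
2, where `upsum_add_two` applies. -/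
theorem upsum_one (P : DyckWord) :
    upsum 1 P.toList = ((components P).map fun Q => upsum 0 Q.toList + Q.semilength + 1).sum := by
  induction P using dyckWord_induction with
  | zero => rw [components_zero]; rfl
  | nest_add P Q hP hQ =>
    rw [upsum_nest_add, upsum_add_two, hQ, components_nest_add, List.map_cons, List.sum_cons]
    norm_num
    omega

theorem sumups_nest_add (P Q : DyckWord) :
    sumups (P.nest + Q) =
      ((components P).map fun R => sumups R + R.semilength + 1).sum + sumups Q := by
  simp [sumups_eq_upsum, upsum_nest_add, upsum_one]

theorem semilength_eq_sum_components (P : DyckWord) :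
    P.semilength = ((components P).map fun Q => Q.semilength + 1).sum := by
  induction P using dyckWord_induction with
  | zero => rw [components_zero]; rfl
  | nest_add P Q hP hQ => simp [components_nest_add, ← hQ]

/-! ### The maps `Φ` and `Θ` -/

theorem staircase_concat (L : List DyckWord) (X : DyckWord) :
    staircase (L ++ [X]) = (staircase L).nest + X := by
  simp [staircase]

theorem staircase_injective : Function.Injective staircase := by
  intro L
  induction L using List.reverseRecOn with
  | nil =>
    intro L' h
    rcases List.eq_nil_or_concat L' with rfl | ⟨L', X, rfl⟩
    · rfl
    · rw [List.concat_eq_append, staircase_concat] at h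
      exact absurd h.symm (nest_add_ne_zero _ _)
  | append_singleton L X ih =>
    intro L' h
    rcases List.eq_nil_or_concat L' with rfl | ⟨L', X', rfl⟩
    · rw [staircase_concat] at h
      exact absurd h (nest_add_ne_zero _ _)
    · rw [List.concat_eq_append, staircase_concat, staircase_concat, nest_add_inj] at h
      rw [List.concat_eq_append, ih h.1, h.2]

theorem semilength_staircase (L : List DyckWord) :
    (staircase L).semilength = (L.map fun X => X.semilength + 1).sum := by
  induction L using List.reverseRecOn with
  | nil => rfl
  | append_singleton L X ih => simp [staircase_concat, ih]; omega

theorem semilength_Phi (P : DyckWord) : (Phi P).semilength = P.semilength := by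
  rw [Phi_eq, semilength_staircase, semilength_eq_sum_components P, List.map_map]
  congr 1
  refine List.map_congr_left fun Q hQ => ?_
  rw [Function.comp_apply, semilength_Phi Q]
termination_by P.semilength
decreasing_by exact semilength_lt_of_mem_components hQ

theorem semilength_Theta (P : DyckWord) : (Theta P).semilength = P.semilength := by
  by_cases h : P = 0
  · rw [h, Theta_zero]
  · rw [Theta_eq P h, DyckWord.semilength_add, DyckWord.semilength_nest, semilength_staircase,
      semilength_Theta P.outsidePart, List.map_map]
    have : ((components P.insidePart).map ((fun X => X.semilength + 1) ∘ Theta)) =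
        (components P.insidePart).map fun X => X.semilength + 1 := by
      refine List.map_congr_left fun Q hQ => ?_
      have := (semilength_lt_of_mem_components hQ).trans (DyckWord.semilength_insidePart_lt h)
      rw [Function.comp_apply, semilength_Theta Q]
    rw [this, ← semilength_eq_sum_components,
      ← DyckWord.semilength_insidePart_add_semilength_outsidePart_add_one h]
    omega
termination_by P.semilength
decreasing_by
  · exact DyckWord.semilength_outsidePart_lt h
  · exact this

/-- Injectivity is asked only at members of `L`, which is what strong induction on semilength
supplies for components. -/
theorem list_eq_of_map_eq {α β : Type*} {f : α → β} {L L' : List α}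
    (hf : ∀ a ∈ L, ∀ b, f a = f b → a = b) (h : L.map f = L'.map f) : L = L' := by
  induction L generalizing L' with
  | nil => exact (List.map_eq_nil_iff.1 h.symm).symm
  | cons a L ih =>
    rcases L' with - | ⟨b, L'⟩
    · simp at h
    · rw [List.map_cons, List.map_cons, List.cons.injEq] at h
      rw [hf a (by simp) b h.1, ih (fun a ha => hf a (by simp [ha])) h.2]

theorem Phi_injective : Function.Injective Phi := by
  intro P
  induction hn : P.semilength using Nat.strong_induction_on generalizing P with
  | _ n ih =>
    intro P' h
    rw [Phi_eq, Phi_eq P'] at h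
    refine components_injective (list_eq_of_map_eq (fun Q hQ Q' hQQ' => ?_)
      (staircase_injective h))
    exact ih _ (hn ▸ semilength_lt_of_mem_components hQ) rfl hQQ'

theorem Theta_injective : Function.Injective Theta := by
  intro P
  induction hn : P.semilength using Nat.strong_induction_on generalizing P with
  | _ n ih =>
    intro P' h
    by_cases hP : P = 0
    · have := congrArg DyckWord.semilength h
      rw [semilength_Theta, semilength_Theta, hP] at this
      have : P'.toList.length = 0 := by
        rw [← DyckWord.two_mul_semilength_eq_length, ← this]; rfl
      rw [hP, DyckWord.toList_eq_nil.1 (List.length_eq_zero_iff.1 this)]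
    by_cases hP' : P' = 0
    · subst hP'
      rw [Theta_zero, Theta_eq P hP] at h
      exact absurd h (nest_add_ne_zero _ _)
    rw [Theta_eq P hP, Theta_eq P' hP', nest_add_inj] at h
    have h1 : P.insidePart = P'.insidePart := by
      refine components_injective (list_eq_of_map_eq (fun Q hQ Q' hQQ' => ?_)
        (staircase_injective h.1))
      exact ih _ (hn ▸ (semilength_lt_of_mem_components hQ).trans
        (DyckWord.semilength_insidePart_lt hP)) rfl hQQ'
    rw [← DyckWord.nest_insidePart_add_outsidePart hP,
      ← DyckWord.nest_insidePart_add_outsidePart hP', h1,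
      ih _ (hn ▸ DyckWord.semilength_outsidePart_lt hP) rfl h.2]

/-! ### The statistic between `sumpeaks` and `sumups` -/

/-- The statistic that `Ψ` carries `sumpeaks` to. -/
def sumnested (P : DyckWord) : ℕ :=
  if h : P = 0 then 0
  else sumnested P.insidePart + sumnested P.outsidePart +
    if P.outsidePart = 0 then 0 else P.insidePart.semilength + 1
termination_by P.semilength
decreasing_by
  · exact DyckWord.semilength_insidePart_lt h
  · exact DyckWord.semilength_outsidePart_lt h

theorem sumnested_zero : sumnested 0 = 0 := by
  rw [sumnested, dif_pos rfl]

theorem sumnested_nest_add (P Q : DyckWord) :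
    sumnested (P.nest + Q) =
      sumnested P + sumnested Q + if Q = 0 then 0 else P.semilength + 1 := by
  rw [sumnested, dif_neg (nest_add_ne_zero P Q), DyckWord.insidePart_add DyckWord.nest_ne_zero,
    DyckWord.outsidePart_add DyckWord.nest_ne_zero, DyckWord.insidePart_nest,
    DyckWord.outsidePart_nest, zero_add]

theorem components_eq_nil {P : DyckWord} : components P = [] ↔ P = 0 := by
  refine ⟨fun h => ?_, fun h => h ▸ components_zero⟩
  rw [← sum_nest_components P, h]
  rfl

/-- Only the last arch has nothing after it, so it alone gets no extra term. This is also the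
component that `staircase_concat` splits off. -/
theorem sumnested_eq_of_components_eq {P : DyckWord} {L : List DyckWord} {X : DyckWord}
    (h : components P = L ++ [X]) :
    sumnested P = (L.map fun Q => sumnested Q + Q.semilength + 1).sum + sumnested X := by
  induction P using dyckWord_induction generalizing L with
  | zero => simp [components_zero] at h
  | nest_add P Q _ hQ =>
    rw [components_nest_add] at h
    rw [sumnested_nest_add]
    rcases L with - | ⟨Y, L⟩
    · simp only [List.nil_append, List.cons.injEq, components_eq_nil] at h
      simp [h, sumnested_zero]
    · rw [List.cons_append, List.cons.injEq] at h
      have hQ0 : Q ≠ 0 := by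
        rintro rfl
        simp [components_zero] at h
      rw [hQ h.2, if_neg hQ0, h.1, List.map_cons, List.sum_cons]
      omega

theorem sumnested_eq_sumups {P P' : DyckWord} (h : Phi P = Theta P') :
    sumnested P = sumups P' := by
  induction hn : P.semilength using Nat.strong_induction_on generalizing P P' with
  | _ n ih =>
    rcases List.eq_nil_or_concat (components P) with hP | ⟨L, X, hP⟩
    · rw [components_eq_nil] at hP
      have : Theta P' = Theta 0 := by
        rw [← h, hP, Phi_eq, components_zero, Theta_zero]; rfl
      rw [hP, Theta_injective this, sumnested_zero]
      rfl
    · rw [List.concat_eq_append] at hP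
      have hP' : P' ≠ 0 := by
        rintro rfl
        rw [Phi_eq, hP, List.map_append, List.map_singleton, staircase_concat, Theta_zero] at h
        exact nest_add_ne_zero _ _ h
      obtain ⟨A, B, rfl⟩ : ∃ A B : DyckWord, P' = A.nest + B :=
        ⟨_, _, (DyckWord.nest_insidePart_add_outsidePart hP').symm⟩
      rw [Phi_eq, hP, List.map_append, List.map_singleton, staircase_concat, Theta_nest_add,
        nest_add_inj] at h
      have hlt : ∀ Q ∈ L ++ [X], Q.semilength < n := fun Q hQ =>
        hn ▸ semilength_lt_of_mem_components (hP ▸ hQ)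
      rw [sumnested_eq_of_components_eq hP, sumups_nest_add, ih _ (hlt X (by simp)) h.2 rfl]
      congr 2
      -- The induction hypothesis is applied entrywise; matched entries have equal semilength
      -- because `Φ` and `Θ` preserve it.
      have hL : ∀ (L M : List DyckWord), (∀ Q ∈ L, Q.semilength < n) →
          L.map Phi = M.map Theta →
          L.map (fun Q => sumnested Q + Q.semilength + 1) =
            M.map fun R => sumups R + R.semilength + 1 := by
        intro L
        induction L with
        | nil =>
          intro M _ hM
          rw [List.map_eq_nil_iff.1 hM.symm]
          rfl
        | cons Q L ihL =>
          intro M hlt hM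
          rcases M with - | ⟨R, M⟩
          · simp at hM
          · rw [List.map_cons, List.map_cons, List.cons.injEq] at hM
            rw [List.map_cons, List.map_cons, ih _ (hlt Q (by simp)) hM.1 rfl,
              ihL M (fun Q hQ => hlt Q (by simp [hQ])) hM.2, ← semilength_Phi Q, hM.1,
              semilength_Theta]
      exact hL L _ (fun Q hQ => hlt Q (by simp [hQ])) (staircase_injective h.1)

/-! ### Run decompositions -/

/-- All exponents in `L` are positive, and the word `ofRuns L`, started at height `h`, never goes
below the axis and ends on it. -/
def IsRunDescent : ℕ → List (ℕ × ℕ) → Prop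
  | h, [] => h = 0
  | h, (a, b) :: L => 0 < a ∧ 0 < b ∧ b ≤ h + a ∧ IsRunDescent (h + a - b) L

theorem ofRuns_cons (a b : ℕ) (L : List (ℕ × ℕ)) :
    ofRuns ((a, b) :: L) = List.replicate a U ++ (List.replicate b D ++ ofRuns L) := by
  simp [ofRuns]

theorem ofRuns_eq_nil {h : ℕ} {L : List (ℕ × ℕ)} (hL : IsRunDescent h L) :
    ofRuns L = [] ↔ L = [] := by
  rcases L with - | ⟨⟨a, b⟩, L⟩
  · simp [ofRuns]
  · have := hL.1
    simp [ofRuns_cons]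
    omega

theorem isDescent_replicate_U (h a : ℕ) (w : List DyckStep) :
    IsDescent h (List.replicate a U ++ w) ↔ IsDescent (h + a) w := by
  induction a generalizing h with
  | zero => rfl
  | succ a ih =>
    rw [List.replicate_succ, List.cons_append, IsDescent, ih, add_right_comm, add_assoc]

theorem isDescent_replicate_D (h b : ℕ) (w : List DyckStep) :
    IsDescent h (List.replicate b D ++ w) ↔ b ≤ h ∧ IsDescent (h - b) w := by
  induction b generalizing h with
  | zero => simp
  | succ b ih =>
    rw [List.replicate_succ, List.cons_append, IsDescent, ih, Nat.sub_sub, add_comm 1, ← and_assoc]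
    exact and_congr_left fun _ => by omega

theorem isDescent_ofRuns {h : ℕ} {L : List (ℕ × ℕ)} (hL : IsRunDescent h L) :
    IsDescent h (ofRuns L) := by
  induction L generalizing h with
  | nil => exact hL
  | cons r L ih =>
    obtain ⟨a, b⟩ := r
    obtain ⟨-, -, hb, hL⟩ := hL
    rw [ofRuns_cons, isDescent_replicate_U, isDescent_replicate_D]
    exact ⟨hb, ih hL⟩

/-- A suffix of a Dyck word may begin with `D`, so the induction carries a leading block of `D`s;
the next `U` in front absorbs it into a run pair. -/
theorem exists_runs_of_isDescent {h : ℕ} {w : List DyckStep} (hw : IsDescent h w) :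
    ∃ b L, w = List.replicate b D ++ ofRuns L ∧ b ≤ h ∧ IsRunDescent (h - b) L := by
  induction w generalizing h with
  | nil =>
    obtain rfl : h = 0 := hw
    exact ⟨0, [], rfl, le_rfl, rfl⟩
  | cons s w ih =>
    cases s
    · obtain ⟨b, L, rfl, hb, hL⟩ := ih hw
      rcases Nat.eq_zero_or_pos b with rfl | hb0
      · rcases L with - | ⟨⟨a, b⟩, L⟩
        · simp [IsRunDescent] at hL
        · obtain ⟨ha, hb', hb'', hL⟩ := hL
          refine ⟨0, (a + 1, b) :: L, ?_, Nat.zero_le _, by omega, hb', by omega, ?_⟩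
          · simp [ofRuns_cons, List.replicate_succ]
          · convert hL using 1
            omega
      · exact ⟨0, (1, b) :: L, by simp [ofRuns_cons], Nat.zero_le _, by omega, hb0, by omega, hL⟩
    · obtain ⟨h0, hw⟩ := hw
      obtain ⟨b, L, rfl, hb, hL⟩ := ih hw
      refine ⟨b + 1, L, by simp [List.replicate_succ], by omega, ?_⟩
      convert hL using 1
      omega

theorem exists_runs (P : DyckWord) : ∃ L, IsRunDescent 0 L ∧ ofRuns L = P.toList := by
  obtain ⟨b, L, hP, hb, hL⟩ := exists_runs_of_isDescent (isDescent_toList P)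
  obtain rfl : b = 0 := by omega
  exact ⟨L, hL, hP.symm⟩

/-- `hw` excludes that `w` begins with `D`, in which case the down-runs would merge. -/
theorem runs_replicate_D {b : ℕ} {w : List DyckStep} (hb : 0 < b)
    (hw : runs w = [] ∨ ∃ a c L, runs w = (a + 1, c) :: L) :
    runs (List.replicate b D ++ w) = (0, b) :: runs w := by
  induction b, hb using Nat.le_induction with
  | base =>
    rw [List.replicate_one, List.singleton_append, runs]
    rcases hw with hw | ⟨a, c, L, hw⟩ <;> rw [hw]
  | succ b _ ih => rw [List.replicate_succ, List.cons_append, runs, ih]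

theorem runs_replicate_U {a c b : ℕ} {w : List DyckStep} {L : List (ℕ × ℕ)}
    (hw : runs w = (c, b) :: L) :
    runs (List.replicate a U ++ w) = (c + a, b) :: L := by
  induction a with
  | zero => simpa using hw
  | succ a ih =>
    rw [List.replicate_succ, List.cons_append, runs, ih]
    rfl

theorem runs_ofRuns {h : ℕ} {L : List (ℕ × ℕ)} (hL : IsRunDescent h L) : runs (ofRuns L) = L := by
  induction L generalizing h with
  | nil => rfl
  | cons r L ih =>
    obtain ⟨a, b⟩ := r
    obtain ⟨-, hb, -, hL⟩ := hL
    have hw := ih hL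
    rw [ofRuns_cons, runs_replicate_U (c := 0) (b := b) (L := L), zero_add]
    rw [runs_replicate_D hb, hw]
    rw [hw]
    rcases L with - | ⟨⟨a', b'⟩, L⟩
    · exact Or.inl rfl
    · obtain ⟨a', rfl⟩ := Nat.exists_eq_add_of_le' hL.1
      exact Or.inr ⟨_, _, _, rfl⟩

theorem count_U_ofRuns (L : List (ℕ × ℕ)) : (ofRuns L).count U = (L.map Prod.fst).sum := by
  induction L with
  | nil => rfl
  | cons r L ih => simp [ofRuns_cons r.1 r.2, ih, List.count_replicate]

theorem count_D_ofRuns (L : List (ℕ × ℕ)) : (ofRuns L).count D = (L.map Prod.snd).sum := by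
  induction L with
  | nil => rfl
  | cons r L ih => simp [ofRuns_cons r.1 r.2, ih, List.count_replicate]

/-! ### `sumpeaks` in terms of the runs -/

/-- The sum of (height of the peak) - 1 over the peaks of `ofRuns L`, started at height `h`. -/
def runPeaksum : ℕ → List (ℕ × ℕ) → ℕ
  | _, [] => 0
  | h, (a, b) :: L => h + a - 1 + runPeaksum (h + a - b) L

theorem peaksum_replicate_D (h b : ℕ) (w : List DyckStep) :
    peaksum h (List.replicate b D ++ w) = peaksum (h - b) w := by
  induction b generalizing h with
  | zero => rfl
  | succ b ih =>
    rw [List.replicate_succ, List.cons_append, peaksum, ih, Nat.sub_sub, add_comm 1]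

theorem peaksum_replicate_U (h : ℕ) {a : ℕ} (ha : 0 < a) (w : List DyckStep) :
    peaksum h (List.replicate a U ++ D :: w) = h + a - 1 + peaksum (h + a) (D :: w) := by
  induction a, ha using Nat.le_induction generalizing h with
  | base => simp [peaksum]
  | succ a ha ih =>
    obtain ⟨a, rfl⟩ := Nat.exists_eq_add_of_le' ha
    rw [List.replicate_succ, List.cons_append, peaksum, ih]
    simp [List.replicate_succ, add_assoc, add_comm 1]

theorem peaksum_ofRuns {h : ℕ} {L : List (ℕ × ℕ)} (hL : IsRunDescent h L) :
    peaksum h (ofRuns L) = runPeaksum h L := by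
  induction L generalizing h with
  | nil => rfl
  | cons r L ih =>
    obtain ⟨a, b⟩ := r
    obtain ⟨ha, hb, -, hL⟩ := hL
    rw [ofRuns_cons, runPeaksum, ← ih hL, ← peaksum_replicate_D]
    obtain ⟨b, rfl⟩ := Nat.exists_eq_add_of_le' hb
    rw [List.replicate_succ, List.cons_append, peaksum_replicate_U h ha]

theorem sumpeaks_of_ofRuns {P : DyckWord} {L : List (ℕ × ℕ)} (hL : IsRunDescent 0 L)
    (hP : ofRuns L = P.toList) : sumpeaks P = runPeaksum 0 L := by
  rw [sumpeaks_eq_peaksum, ← hP, peaksum_ofRuns hL]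

/-! ### The bijection `δ` -/

/-- Here `k` is the down-run held back so far: the shifted word is at height `h` where the original
one is at `h - k`. When `L` is exhausted, `h = k` and the first down-run of `M` pays it off. -/
theorem isRunDescent_shiftRuns {h k : ℕ} {L M : List (ℕ × ℕ)} (hk : k ≤ h)
    (hk0 : L ≠ [] → 0 < k) (hL : IsRunDescent (h - k) L) (hM : IsRunDescent 0 M) (hM0 : M ≠ []) :
    IsRunDescent h (shiftRuns k L M) := by
  induction L generalizing h k with
  | nil =>
    obtain ⟨⟨c, d⟩, M, rfl⟩ := List.exists_cons_of_ne_nil hM0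
    obtain ⟨hc, hd, hcd, hM⟩ := hM
    have : h - k = 0 := hL
    refine ⟨hc, by omega, by omega, ?_⟩
    convert hM using 1
    omega
  | cons r L ih =>
    obtain ⟨a, b⟩ := r
    obtain ⟨ha, hb, hab, hL⟩ := hL
    refine ⟨ha, hk0 (by simp), by omega, ih (by omega) (fun _ => hb) ?_⟩
    convert hL using 1
    omega

/-- Each peak of `L`, and then the first peak of `M`, is raised by the down-run pending before it;
these runs are `k` and the down-runs of `L`. -/
theorem runPeaksum_shiftRuns {h k : ℕ} {L M : List (ℕ × ℕ)} (hk : k ≤ h)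
    (hL : IsRunDescent (h - k) L) (hM : IsRunDescent 0 M) (hM0 : M ≠ []) :
    runPeaksum h (shiftRuns k L M) =
      runPeaksum (h - k) L + runPeaksum 0 M + (k + (L.map Prod.snd).sum) := by
  induction L generalizing h k with
  | nil =>
    obtain ⟨⟨c, d⟩, M, rfl⟩ := List.exists_cons_of_ne_nil hM0
    obtain ⟨hc, hd, hcd, hM⟩ := hM
    have : h - k = 0 := hL
    simp only [shiftRuns, runPeaksum, List.map_nil, List.sum_nil]
    rw [show h + c - (k + d) = 0 + c - d by omega]
    omega
  | cons r L ih =>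
    obtain ⟨a, b⟩ := r
    obtain ⟨ha, hb, hab, hL⟩ := hL
    have e : h + a - k - b = h - k + a - b := by omega
    simp only [shiftRuns, runPeaksum, List.map_cons, List.sum_cons]
    rw [ih (by omega) (by rwa [e]), e]
    omega

theorem sum_fst_shiftRuns (k : ℕ) (L : List (ℕ × ℕ)) {M : List (ℕ × ℕ)} (hM0 : M ≠ []) :
    ((shiftRuns k L M).map Prod.fst).sum = (L.map Prod.fst).sum + (M.map Prod.fst).sum := by
  induction L generalizing k with
  | nil =>
    obtain ⟨⟨c, d⟩, M, rfl⟩ := List.exists_cons_of_ne_nil hM0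
    simp [shiftRuns]
  | cons r L ih =>
    obtain ⟨a, b⟩ := r
    simp [shiftRuns, ih, add_assoc]

/-- `M` starts at the first pair whose down-run exceeds the height where its up-run starts; the
excess is the first down-run of `M`. The final pair qualifies, so such a pair exists. The clause on
`k = 0` is what lets `Q` be empty. -/
theorem exists_shiftRuns_eq {h : ℕ} {E : List (ℕ × ℕ)} (hE : IsRunDescent h E) (hE0 : E ≠ []) :
    ∃ k L M, k ≤ h ∧ IsRunDescent (h - k) L ∧ IsRunDescent 0 M ∧ M ≠ [] ∧
      shiftRuns k L M = E ∧ (k = 0 → h = 0 ∧ L = []) := by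
  induction E generalizing h with
  | nil => exact absurd rfl hE0
  | cons r E ih =>
    obtain ⟨e, f⟩ := r
    obtain ⟨he, hf, hef, hE⟩ := hE
    by_cases hfh : h < f
    · refine ⟨h, [], (e, f - h) :: E, le_rfl, Nat.sub_self h, ⟨he, by omega, by omega, ?_⟩,
        by simp, ?_, fun h0 => ⟨h0, rfl⟩⟩
      · convert hE using 1
        omega
      · rw [shiftRuns, Nat.add_sub_cancel' hfh.le]
    · have hE0 : E ≠ [] := by
        rintro rfl
        have : h + e - f = 0 := hE
        omega
      obtain ⟨k, L, M, hk, hL, hM, hM0, rfl, h0⟩ := ih hE hE0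
      refine ⟨f, (e, k) :: L, M, by omega, ⟨he, ?_, by omega, ?_⟩, hM, hM0, rfl, by omega⟩
      · by_contra hk0
        have := h0 (by omega)
        omega
      · convert hL using 1
        omega

theorem exponents_zero : exponents 0 = [(0, 0)] := if_pos rfl

theorem exponents_of_ofRuns {Q : DyckWord} {r : ℕ × ℕ} {L : List (ℕ × ℕ)}
    (hL : IsRunDescent 0 (r :: L)) (hQ : ofRuns (r :: L) = Q.toList) :
    exponents Q = r :: L := by
  have h0 : Q ≠ 0 := by
    rw [← DyckWord.toList_ne_nil, ← hQ, Ne, ofRuns_eq_nil hL]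
    simp
  rw [exponents, if_neg h0, ← hQ, runs_ofRuns hL]

/-- The exponents of `Q`, with the convention for the empty path. -/
theorem exists_exponents (Q : DyckWord) : ∃ a b L, exponents Q = (a, b) :: L ∧
    ofRuns ((a, b) :: L) = Q.toList ∧ b ≤ a ∧ IsRunDescent (a - b) L ∧
    (Q = 0 ∧ a = 0 ∧ b = 0 ∧ L = [] ∨ Q ≠ 0 ∧ 0 < a ∧ 0 < b) := by
  by_cases hQ : Q = 0
  · subst hQ
    exact ⟨0, 0, [], exponents_zero, rfl, le_rfl, rfl, by simp⟩
  · obtain ⟨L, hL, hLQ⟩ := exists_runs Q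
    rcases L with - | ⟨⟨a, b⟩, L⟩
    · exact absurd (DyckWord.toList_eq_nil.1 hLQ.symm) hQ
    · have he := exponents_of_ofRuns hL hLQ
      obtain ⟨ha, hb, hab, hL⟩ := hL
      rw [zero_add] at hab hL
      exact ⟨a, b, L, he, hLQ, hab, hL, Or.inr ⟨hQ, ha, hb⟩⟩

/-- The truncation `0 - 1 = 0` makes the formula cover the empty path. -/
theorem sumpeaks_of_exponents {Q : DyckWord} {a b : ℕ} {L : List (ℕ × ℕ)}
    (hQ : ofRuns ((a, b) :: L) = Q.toList) (hab : b ≤ a) (hL : IsRunDescent (a - b) L)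
    (h0 : Q = 0 ∧ a = 0 ∧ b = 0 ∧ L = [] ∨ Q ≠ 0 ∧ 0 < a ∧ 0 < b) :
    sumpeaks Q = a - 1 + runPeaksum (a - b) L := by
  rcases h0 with ⟨rfl, rfl, rfl, rfl⟩ | ⟨-, ha, hb⟩
  · rfl
  · rw [sumpeaks_of_ofRuns (L := (a, b) :: L) ⟨ha, hb, by omega, by rwa [zero_add]⟩ hQ, runPeaksum,
      zero_add]

theorem sumpeaks_delta {P Q R : DyckWord} (hP : delta Q R = P.toList) :
    sumpeaks P = sumpeaks Q + sumpeaks R +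
      if Q = 0 then 0 else if R = 0 then 1 else Q.semilength + 1 := by
  obtain ⟨a, b, L, he, hQ, hab, hL, h0⟩ := exists_exponents Q
  have hsp := sumpeaks_of_exponents hQ hab hL h0
  have hlen : Q.semilength = b + (L.map Prod.snd).sum := by
    rw [DyckWord.semilength_eq_count_D, ← hQ, count_D_ofRuns]
    simp
  simp only [delta, he] at hP
  by_cases hR : R = 0
  · rw [if_pos hR] at hP
    have hE : IsRunDescent 0 ((a + 1, b + 1) :: L) :=
      ⟨by omega, by omega, by omega, by rwa [show 0 + (a + 1) - (b + 1) = a - b by omega]⟩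
    have hR0 : sumpeaks R = 0 := hR ▸ rfl
    rw [sumpeaks_of_ofRuns hE hP, hsp, runPeaksum, if_pos hR, hR0,
      show 0 + (a + 1) - (b + 1) = a - b by omega]
    rcases h0 with ⟨h, rfl, -⟩ | ⟨h, ha, -⟩
    · simp [h]
    · rw [if_neg h]
      omega
  · rw [if_neg hR] at hP
    obtain ⟨M, hM, hMR⟩ := exists_runs R
    have hM0 : M ≠ [] := by
      rintro rfl
      exact hR (DyckWord.toList_eq_nil.1 hMR.symm)
    rw [← hMR, runs_ofRuns hM, shiftRuns] at hP
    have e : 0 + (a + 1) - 1 = a := by omega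
    have hE : IsRunDescent 0 ((a + 1, 1) :: shiftRuns b L M) := by
      refine ⟨by omega, one_pos, by omega, ?_⟩
      rw [e]
      refine isRunDescent_shiftRuns hab (fun hL0 => ?_) hL hM hM0
      rcases h0 with ⟨-, -, -, h⟩ | ⟨-, -, h⟩
      · exact absurd h hL0
      · exact h
    rw [sumpeaks_of_ofRuns hE hP, hsp, sumpeaks_of_ofRuns hM hMR, runPeaksum, if_neg hR, hlen, e,
      runPeaksum_shiftRuns hab hL hM hM0]
    rcases h0 with ⟨h, rfl, rfl, rfl⟩ | ⟨h, ha, -⟩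
    · simp [h]
    · rw [if_neg h]
      omega

theorem exists_isDeltaPreimage {P : DyckWord} (hP : P ≠ 0) : ∃ QR, IsDeltaPreimage P QR := by
  obtain ⟨E, hE, hEP⟩ := exists_runs P
  rcases E with - | ⟨⟨e, f⟩, E⟩
  · exact absurd (DyckWord.toList_eq_nil.1 hEP.symm) hP
  have hlenP : P.semilength = e + (E.map Prod.fst).sum := by
    rw [DyckWord.semilength, ← hEP, count_U_ofRuns]
    simp
  have hlen : ∀ {Q : DyckWord} {L : List (ℕ × ℕ)}, ofRuns L = Q.toList →
      Q.semilength = (L.map Prod.fst).sum := fun {Q L} h => by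
    rw [DyckWord.semilength, ← h, count_U_ofRuns]
  obtain ⟨he, hf, hef, hE⟩ := hE
  rw [zero_add] at hef hE
  obtain ⟨e, rfl⟩ := Nat.exists_eq_add_of_le' he
  -- A first down-run of length at least 2 signals `R = ∅`; length 1 means `P = UD` or `R` nonempty.
  rcases Nat.eq_or_lt_of_le (Nat.succ_le_of_lt hf) with hf1 | hf1
  · obtain rfl : f = 1 := hf1.symm
    by_cases hE0 : E = []
    · subst hE0
      obtain rfl : e = 0 := hE
      refine ⟨(0, 0), by simp [hlenP], ?_⟩
      simp [delta, exponents_zero, hEP]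
    · obtain ⟨k, L, M, hk, hL, hM, hM0, rfl, hk0⟩ := exists_shiftRuns_eq hE hE0
      rw [Nat.add_sub_cancel] at hk hL hk0
      obtain ⟨R, hR⟩ := exists_toList_eq (isDescent_ofRuns hM)
      have hR0 : R ≠ 0 := by
        rw [← DyckWord.toList_ne_nil, hR, Ne, ofRuns_eq_nil hM]
        exact hM0
      obtain ⟨Q, hQ, hQe⟩ : ∃ Q : DyckWord, ofRuns ((e, k) :: L) = Q.toList ∧
          exponents Q = (e, k) :: L := by
        rcases Nat.eq_zero_or_pos k with rfl | hk'
        · obtain ⟨rfl, rfl⟩ := hk0 rfl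
          exact ⟨0, rfl, exponents_zero⟩
        · have h : IsRunDescent 0 ((e, k) :: L) :=
            ⟨by omega, hk', by omega, by rwa [zero_add]⟩
          obtain ⟨Q, hQ⟩ := exists_toList_eq (isDescent_ofRuns h)
          exact ⟨Q, hQ.symm, exponents_of_ofRuns h hQ.symm⟩
      refine ⟨(Q, R), ?_, ?_⟩
      · rw [hlenP, hlen hQ, hlen hR.symm, sum_fst_shiftRuns k L hM0]
        simp
        omega
      · simp only [delta, hQe]
        rw [if_neg hR0, hR, runs_ofRuns hM, ← hEP, shiftRuns]
  · obtain ⟨f, rfl⟩ := Nat.exists_eq_add_of_le' hf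
    have h : IsRunDescent 0 ((e, f) :: E) :=
      ⟨by omega, by omega, by omega, by rwa [show 0 + e - f = e + 1 - (f + 1) by omega]⟩
    obtain ⟨Q, hQ⟩ := exists_toList_eq (isDescent_ofRuns h)
    refine ⟨(Q, 0), ?_, ?_⟩
    · rw [hlenP, hlen hQ.symm]
      simp
      omega
    · simp only [delta, exponents_of_ofRuns h hQ.symm]
      rw [if_pos trivial, hEP]

/-! ### The map `Ψ` -/

/-- The word `δ(Q, R)` for the pair `(X, Y)` with `Ψ(δ(Q, R)) = UΨ(X)DΨ(Y)`. -/
noncomputable def deltaSwap (X Y : DyckWord) : List DyckStep :=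
  if X = 0 ∨ Y = 0 then delta Y X else delta X Y

theorem Psi_zero : Psi 0 = 0 := by
  rw [Psi, dif_neg]
  rintro ⟨QR, h, -⟩
  simp at h

/-- Taking `(X, Y)` as `(∅, Q)`, `(R, ∅)` or `(Q, R)` merges the three cases of `Ψ`, and the extra
term of `sumpeaks_delta` becomes that of `sumnested_nest_add`. Any preimage under `δ` will do. -/
theorem exists_Psi_eq {P : DyckWord} (hP : P ≠ 0) : ∃ X Y : DyckWord,
    Psi P = (Psi X).nest + Psi Y ∧ X.semilength + Y.semilength + 1 = P.semilength ∧
      deltaSwap X Y = P.toList ∧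
      sumpeaks P = sumpeaks X + sumpeaks Y + if Y = 0 then 0 else X.semilength + 1 := by
  have h := exists_isDeltaPreimage hP
  rw [Psi, dif_pos h]
  obtain ⟨h1, h2⟩ := h.choose_spec
  have h3 := sumpeaks_delta h2
  generalize h.choose.1 = Q at *
  generalize h.choose.2 = R at *
  by_cases hR : R = 0
  · subst hR
    refine ⟨0, Q, by rw [if_pos rfl, Psi_zero], by omega, by rw [deltaSwap, if_pos (Or.inl rfl), h2],
      ?_⟩
    rw [h3, add_comm (sumpeaks Q)]
    simp
  by_cases hQ : Q = 0
  · subst hQ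
    refine ⟨R, 0, by rw [if_neg hR, if_pos rfl, Psi_zero, add_zero], by omega,
      by rw [deltaSwap, if_pos (Or.inr rfl), h2], ?_⟩
    rw [h3, add_comm (sumpeaks 0)]
    simp
  refine ⟨Q, R, by rw [if_neg hR, if_neg hQ], h1, ?_, ?_⟩
  · rw [deltaSwap, if_neg (by simp [hQ, hR]), h2]
  · rw [h3, if_neg hQ, if_neg hR, if_neg hR]

theorem Psi_eq_zero {P : DyckWord} : Psi P = 0 ↔ P = 0 := by
  refine ⟨fun h => ?_, fun h => h ▸ Psi_zero⟩
  by_contra hP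
  obtain ⟨X, Y, hXY, -⟩ := exists_Psi_eq hP
  exact nest_add_ne_zero _ _ (hXY.symm.trans h)

theorem semilength_Psi (P : DyckWord) : (Psi P).semilength = P.semilength := by
  induction hn : P.semilength using Nat.strong_induction_on generalizing P with
  | _ n ih =>
    by_cases hP : P = 0
    · rw [← hn, hP, Psi_zero]
    · obtain ⟨X, Y, hXY, hlen, -⟩ := exists_Psi_eq hP
      rw [hXY, DyckWord.semilength_add, DyckWord.semilength_nest,
        ih _ (by omega) X rfl, ih _ (by omega) Y rfl]
      omega

theorem sumnested_Psi (P : DyckWord) : sumnested (Psi P) = sumpeaks P := by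
  induction hn : P.semilength using Nat.strong_induction_on generalizing P with
  | _ n ih =>
    by_cases hP : P = 0
    · rw [hP, Psi_zero, sumnested_zero]
      rfl
    · obtain ⟨X, Y, hXY, hlen, -, hsp⟩ := exists_Psi_eq hP
      rw [hXY, sumnested_nest_add, ih _ (by omega) X rfl, ih _ (by omega) Y rfl, hsp,
        semilength_Psi]
      simp only [Psi_eq_zero]

/-- `Ψ(P)` determines `Ψ(X)` and `Ψ(Y)`, hence `X` and `Y` by induction, and `deltaSwap X Y` returns
`P`. Injectivity of `δ` is not needed. -/
theorem Psi_injective : Function.Injective Psi := by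
  intro P
  induction hn : P.semilength using Nat.strong_induction_on generalizing P with
  | _ n ih =>
    intro P' h
    by_cases hP : P = 0
    · rw [hP, Psi_zero] at h
      rw [hP, Psi_eq_zero.1 h.symm]
    have hP' : P' ≠ 0 := by
      rintro rfl
      rw [Psi_zero, Psi_eq_zero] at h
      exact hP h
    obtain ⟨X, Y, hXY, hlen, hd, -⟩ := exists_Psi_eq hP
    obtain ⟨X', Y', hXY', -, hd', -⟩ := exists_Psi_eq hP'
    rw [hXY, hXY', nest_add_inj] at h
    rw [DyckWord.ext_iff, ← hd, ← hd', ih _ (by omega) rfl h.1, ih _ (by omega) rfl h.2]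

/-! ### The bijections on Dyck paths of a fixed semilength -/

/-- An injective map that preserves the semilength, restricted to `Dyck n`. -/
noncomputable def restrictEquiv (n : ℕ) (f : DyckWord → DyckWord)
    (hf : ∀ P, (f P).semilength = P.semilength) (hinj : Function.Injective f) :
    Dyck n ≃ Dyck n :=
  Equiv.ofBijective (fun P => ⟨f P, (hf P).trans P.2⟩)
    (Finite.injective_iff_bijective.1 fun _ _ h => Subtype.ext (hinj (Subtype.ext_iff.1 h)))

end DyckPaths

open Polynomial in
theorem mainTheorem2 (n : ℕ) :
    (∃ Ψ Φ Θ Λ : DyckPaths.Dyck n ≃ DyckPaths.Dyck n,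
      (∀ P, (Ψ P : DyckWord) = DyckPaths.Psi P) ∧
      (∀ P, (Φ P : DyckWord) = DyckPaths.Phi P) ∧
      (∀ P, (Θ P : DyckWord) = DyckPaths.Theta P) ∧
      (∀ P, Λ P = Θ.symm (Φ (Ψ P))) ∧
      (∀ P : DyckPaths.Dyck n, DyckPaths.sumpeaks P = DyckPaths.sumups (Λ P))) ∧
    (∑ P : DyckPaths.Dyck n, (X : ℤ[X]) ^ DyckPaths.sumpeaks P) =
      ∑ P : DyckPaths.Dyck n, (X : ℤ[X]) ^ DyckPaths.sumups P := by
  let Ψ := DyckPaths.restrictEquiv n _ DyckPaths.semilength_Psi DyckPaths.Psi_injective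
  let Φ := DyckPaths.restrictEquiv n _ DyckPaths.semilength_Phi DyckPaths.Phi_injective
  let Θ := DyckPaths.restrictEquiv n _ DyckPaths.semilength_Theta DyckPaths.Theta_injective
  let Λ := (Ψ.trans Φ).trans Θ.symm
  have hΛ : ∀ P : DyckPaths.Dyck n, DyckPaths.sumpeaks P = DyckPaths.sumups (Λ P) := fun P => by
    have h : Θ (Λ P) = Φ (Ψ P) := Θ.apply_symm_apply _
    rw [← DyckPaths.sumnested_Psi]
    exact DyckPaths.sumnested_eq_sumups (congrArg Subtype.val h).symm
  exact ⟨⟨Ψ, Φ, Θ, Λ, fun _ => rfl, fun _ => rfl, fun _ => rfl, fun _ => rfl, hΛ⟩,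
    Fintype.sum_equiv Λ _ _ fun P => by rw [hΛ]⟩
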